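/- \textbf{Definitions.} A \emph{multiring} is $(R,+,\cdot,-,0,1)$, where $(R,\cdot,1)$ is a commutative monoid with $a\cdot 0=0$ for all $a$, where $+:R\times R\to\mathcal P(R)\setminus\{\emptyset\}$ is commutative and associative (with $x+(y+z)=\bigcup_{w\in y+z}(x+w)$ and $(x+y)+z=\bigcup_{t\in x+y}(t+z)$), $y\in 0+x\iff x=y$, $z\in x+y$ implies $x\in z+(-y)$ and $y\in(-x)+z$, and $c\in a+b$ implies $cd\in ad+bd$. A multiring is \emph{real reduced} if $1\neq 0$, $a^3=a$, $c\in a+ab^2\Rightarrow c=a$, and $c,d\in a^2+b^2\Rightarrow c=d$, for all $a,b,c,d$. A morphism of (real reduced) multirings is a map $f$ with $f(0)=0$, $f(1)=1$, $f(ab)=f(a)f(b)$, $f(-a)=-f(a)$ and $c\in a+b\Rightarrow f(c)\in f(a)+f(b)$. Let $\mathcal{MR}_{red}$ be the category of real reduced multirings. A \emph{ternary semigroup} is $(S,\cdot,1,0,-1)$, where $(S,\cdot,1)$ is a commutative monoid, $x^3=x$ and $x\cdot0=0$ for all $x$, $-1\ne1$, $(-1)(-1)=1$, and $x=(-1)\cdot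 x$ implies $x=0$; write $-x=(-1)\cdot x$. Given a ternary relation $a\in D(b,c)$ on $S$, put $a\in D^t(b,c)$ iff $a\in D(b,c)$, $-b\in D(-a,c)$ and $-c\in D(b,-a)$. A \emph{real semigroup} is a ternary semigroup with a ternary relation $D$ such that for all $a,b,c,d,e$: \begin{itemize} \item[RS0] $c\in D(a,b)\iff c\in D(b,a)$; \item[RS1] $a\in D(a,b)$; \item[RS2] $a\in D(b,c)\Rightarrow ad\in D(bd,cd)$; \item[RS3] if $a\in D^t(b,c)$ and $c\in D^t(d,e)$, then there is $x\in D^t(b,d)$ with $a\in D^t(x,e)$; \item[RS4] $e\in D(c^2a,d^2b)\Rightarrow e\in D(a,b)$; \item[RS5] if $ad=bd$, $ae=be$ and $c\in D(d,e)$, then $ac=bc$; \item[RS6] $c\in D(a,b)\Rightarrow c\in D^t(c^2a,c^2b)$; \item[RS7] $D^t(a,-b)\cap D^t(b,-a)\neq\emptyset\Rightarrow a=b$; \item[RS8] $a\in D(b,c)\Rightarrow a^2\in D(b^2,c^2)$. \end{itemize} A morphism of real semigroups is a map preserving products, $1$, $0$, $-1$ and $D$. Let $\mathcal{RS}$ be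 the category of real semigroups. \textbf{Statement.} \begin{enumerate} \item For every real semigroup $(G,\cdot,1,0,-1,D)$, the structure $(G,+,\cdot,-,0,1)$ with $a+b:=D^t(a,b)$ and $-g:=(-1)\cdot g$ is a real reduced multiring; let $M:\mathcal{RS}\to\mathcal{MR}_{red}$ be the resulting functor, acting as the identity on underlying maps. \item For every real reduced multiring $A$, the structure $(A,\cdot,1,0,-1,D)$ with $d\in D(a,b):\iff d\in d^2a+d^2b$ is a real semigroup, and its transversal representation is $D^t(a,b)=a+b$; let $S:\mathcal{MR}_{red}\to\mathcal{RS}$ be the resulting functor, acting as the identity on underlying maps. \item $M$ and $S$ are mutually quasi-inverse equivalences of categories. In particular $\mathcal{RS}$ and $\mathcal{MR}_{red}$ are equivalent. \end{enumerate} -/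

import Mathlib

open CategoryTheory

universe u

/-! ## Multirings -/

/-- A commutative multigroup: a set with a commutative operation taking values in the non-empty
subsets, an inversion and a neutral element. -/
structure IsCommMultigroup {G : Type u} (add : G → G → Set G) (neg : G → G) (zero : G) :
    Prop where
  nonempty : ∀ x y, (add x y).Nonempty
  reversible : ∀ x y z, z ∈ add x y → x ∈ add z (neg y) ∧ y ∈ add (neg x) z
  mem_zero_add : ∀ x y, y ∈ add zero x ↔ x = y
  assoc : ∀ x y z, (⋃ w ∈ add y z, add x w) = ⋃ t ∈ add x y, add t z
  comm : ∀ x y, add x y = add y x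

/-- Multiring axioms for `(R, add, *, neg, 0, 1)`. That `(R, *, 1)` is a commutative monoid in which
`a * 0 = 0` is expressed by the class `CommMonoidWithZero`. -/
structure IsMultiring {R : Type u} [CommMonoidWithZero R] (add : R → R → Set R) (neg : R → R) :
    Prop where
  multigroup : IsCommMultigroup add neg 0
  mul_mem : ∀ a b c d, c ∈ add a b → c * d ∈ add (a * d) (b * d)

/-- Real reduced multirings. -/
structure IsRealReducedMultiring {R : Type u} [CommMonoidWithZero R] (add : R → R → Set R)
    (neg : R → R) : Prop extends IsMultiring add neg where
  one_ne_zero : (1 : R) ≠ 0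
  cube : ∀ a : R, a ^ 3 = a
  eq_of_mem_add_mul_sq : ∀ a b c : R, c ∈ add a (a * b ^ 2) → c = a
  eq_of_mem_sq_add_sq : ∀ a b c d : R, c ∈ add (a ^ 2) (b ^ 2) → d ∈ add (a ^ 2) (b ^ 2) → c = d

/-- A (bundled) multiring. -/
structure Multiring : Type (u + 1) where
  carrier : Type u
  [str : CommMonoidWithZero carrier]
  add : carrier → carrier → Set carrier
  neg : carrier → carrier
  isMultiring : IsMultiring add neg

attribute [instance] Multiring.str

/-- Morphisms of multirings. Compatibility with `0`, `1` and products is the parent structure. -/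
@[ext]
structure MultiringHom (A B : Multiring.{u}) extends A.carrier →*₀ B.carrier where
  map_mem_add : ∀ a b c, c ∈ A.add a b → toFun c ∈ B.add (toFun a) (toFun b)
  map_neg : ∀ a, toFun (A.neg a) = B.neg (toFun a)

/-- A (bundled) real reduced multiring. -/
structure RealReducedMultiring : Type (u + 1) extends Multiring.{u} where
  isRealReduced : IsRealReducedMultiring add neg

/-- The category of real reduced multirings; its morphisms are the morphisms of multirings. -/
instance : Category RealReducedMultiring.{u} where
  Hom A B := MultiringHom A.toMultiring B.toMultiring
  id A :=
    { toMonoidWithZeroHom := MonoidWithZeroHom.id A.carrier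
      map_mem_add := fun _ _ _ h => h
      map_neg := fun _ => rfl }
  comp f g :=
    { toMonoidWithZeroHom := g.toMonoidWithZeroHom.comp f.toMonoidWithZeroHom
      map_mem_add := fun _ _ _ h => g.map_mem_add _ _ _ (f.map_mem_add _ _ _ h)
      map_neg := fun a => (congrArg g.toFun (f.map_neg a)).trans (g.map_neg _) }

/-! ## Real semigroups -/

/-- Ternary semigroup axioms for `(S, *, 1, 0, m)`, where `m` is the constant `-1`. That `(S, *, 1)`
is a commutative semigroup with unity in which `x * 0 = 0` is expressed by `CommMonoidWithZero`. -/
structure IsTernarySemigroup {S : Type u} [CommMonoidWithZero S] (m : S) : Prop where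
  cube : ∀ x : S, x ^ 3 = x
  negOne_ne_one : m ≠ 1
  negOne_mul_negOne : m * m = 1
  eq_zero_of_eq_neg : ∀ x : S, x = m * x → x = 0

/-- Transversal representation: `a ∈ D^t(b,c)` iff `a ∈ D(b,c)`, `-b ∈ D(-a,c)` and
`-c ∈ D(b,-a)`, where `-x` is `m * x`. -/
def transversalRep {S : Type u} [CommMonoidWithZero S] (m : S) (D : S → S → Set S) (b c : S) :
    Set S :=
  {a | a ∈ D b c ∧ m * b ∈ D (m * a) c ∧ m * c ∈ D b (m * a)}

/-- Real semigroup axioms for `(S, *, 1, 0, m, D)`, where `m` is the constant `-1`. -/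
structure IsRealSemigroup {S : Type u} [CommMonoidWithZero S] (m : S) (D : S → S → Set S) :
    Prop extends IsTernarySemigroup m where
  rs0 : ∀ a b c, c ∈ D a b ↔ c ∈ D b a
  rs1 : ∀ a b, a ∈ D a b
  rs2 : ∀ a b c d, a ∈ D b c → a * d ∈ D (b * d) (c * d)
  rs3 : ∀ a b c d e, a ∈ transversalRep m D b c → c ∈ transversalRep m D d e →
    ∃ x ∈ transversalRep m D b d, a ∈ transversalRep m D x e
  rs4 : ∀ a b c d e, e ∈ D (c ^ 2 * a) (d ^ 2 * b) → e ∈ D a b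
  rs5 : ∀ a b c d e, a * d = b * d → a * e = b * e → c ∈ D d e → a * c = b * c
  rs6 : ∀ a b c, c ∈ D a b → c ∈ transversalRep m D (c ^ 2 * a) (c ^ 2 * b)
  rs7 : ∀ a b, (transversalRep m D a (m * b) ∩ transversalRep m D b (m * a)).Nonempty → a = b
  rs8 : ∀ a b c, a ∈ D b c → a ^ 2 ∈ D (b ^ 2) (c ^ 2)

/-- A (bundled) real semigroup. -/
structure RealSemigroup : Type (u + 1) where
  carrier : Type u
  [str : CommMonoidWithZero carrier]
  negOne : carrier
  rep : carrier → carrier → Set carrier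
  isRealSemigroup : IsRealSemigroup negOne rep

attribute [instance] RealSemigroup.str

/-- Morphisms of real semigroups. -/
@[ext]
structure RealSemigroupHom (G H : RealSemigroup.{u}) extends G.carrier →*₀ H.carrier where
  map_negOne : toFun G.negOne = H.negOne
  map_mem_rep : ∀ a b c, a ∈ G.rep b c → toFun a ∈ H.rep (toFun b) (toFun c)

/-- The category of real semigroups. -/
instance : Category RealSemigroup.{u} where
  Hom G H := RealSemigroupHom G H
  id G :=
    { toMonoidWithZeroHom := MonoidWithZeroHom.id G.carrier
      map_negOne := rfl
      map_mem_rep := fun _ _ _ h => h }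
  comp f g :=
    { toMonoidWithZeroHom := g.toMonoidWithZeroHom.comp f.toMonoidWithZeroHom
      map_negOne := (congrArg g.toFun f.map_negOne).trans g.map_negOne
      map_mem_rep := fun _ _ _ h => g.map_mem_rep _ _ _ (f.map_mem_rep _ _ _ h) }

/-! ## The two constructions -/

namespace RealSemigroup

/-- The multivalued sum of a real semigroup: `a + b = D^t(a,b)`. -/
def sum (G : RealSemigroup.{u}) (a b : G.carrier) : Set G.carrier :=
  transversalRep G.negOne G.rep a b

/-- The map `g ↦ (-1) * g` of a real semigroup. -/
def opp (G : RealSemigroup.{u}) (g : G.carrier) : G.carrier := G.negOne * g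

theorem map_opp {G H : RealSemigroup.{u}} (f : RealSemigroupHom G H) (a : G.carrier) :
    f.toFun (G.opp a) = H.opp (f.toFun a) :=
  (f.map_mul' _ _).trans (congrArg (· * f.toFun a) f.map_negOne)

theorem map_mem_sum {G H : RealSemigroup.{u}} (f : RealSemigroupHom G H) (a b c : G.carrier)
    (h : c ∈ G.sum a b) : f.toFun c ∈ H.sum (f.toFun a) (f.toFun b) := by
  obtain ⟨h1, h2, h3⟩ := h
  have e := map_opp f
  simp only [opp] at e
  refine ⟨f.map_mem_rep _ _ _ h1, ?_, ?_⟩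
  · rw [← e, ← e]; exact f.map_mem_rep _ _ _ h2
  · rw [← e, ← e]; exact f.map_mem_rep _ _ _ h3

/-- Given the fact that `(G, D^t, *, g ↦ -g, 0, 1)` is a real reduced multiring for every real
semigroup `G`, the functor sending `G` to that multiring and a morphism to the same map. -/
def toMultiringFunctor (h : ∀ G : RealSemigroup.{u}, IsRealReducedMultiring G.sum G.opp) :
    RealSemigroup.{u} ⥤ RealReducedMultiring.{u} where
  obj G :=
    { carrier := G.carrier
      add := G.sum
      neg := G.opp
      isMultiring := (h G).toIsMultiring
      isRealReduced := h G }
  map f :=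
    { toMonoidWithZeroHom := RealSemigroupHom.toMonoidWithZeroHom f
      map_mem_add := map_mem_sum f
      map_neg := map_opp f }

end RealSemigroup

namespace RealReducedMultiring

/-- The representation relation of a real reduced multiring:
`d ∈ D(a,b)` iff `d ∈ d²a + d²b`. -/
def rep (A : RealReducedMultiring.{u}) (a b : A.carrier) : Set A.carrier :=
  {d | d ∈ A.add (d ^ 2 * a) (d ^ 2 * b)}

/-- The constant `-1` of a multiring. -/
def negOne (A : RealReducedMultiring.{u}) : A.carrier := A.neg 1

theorem map_negOne {A B : RealReducedMultiring.{u}}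
    (f : MultiringHom A.toMultiring B.toMultiring) : f.toFun A.negOne = B.negOne :=
  (f.map_neg 1).trans (congrArg B.neg f.map_one')

theorem map_mem_rep {A B : RealReducedMultiring.{u}}
    (f : MultiringHom A.toMultiring B.toMultiring) (d a b : A.carrier) (h : d ∈ A.rep a b) :
    f.toFun d ∈ B.rep (f.toFun a) (f.toFun b) := by
  have e : ∀ x y : A.carrier, f.toFun (x ^ 2 * y) = f.toFun x ^ 2 * f.toFun y := fun x y =>
    (map_mul f.toMonoidWithZeroHom _ _).trans
      (congrArg (· * f.toFun y) (map_pow f.toMonoidWithZeroHom _ _))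
  have := f.map_mem_add _ _ _ h
  rw [e, e] at this
  exact this

/-- Given the fact that `(A, *, 1, 0, -1, D)`, with `D` as above, is a real semigroup for every real
reduced multiring `A`, the functor sending `A` to that real semigroup and a morphism to the same
map. -/
def toRealSemigroupFunctor
    (h : ∀ A : RealReducedMultiring.{u}, IsRealSemigroup A.negOne A.rep) :
    RealReducedMultiring.{u} ⥤ RealSemigroup.{u} where
  obj A :=
    { carrier := A.carrier
      negOne := A.negOne
      rep := A.rep
      isRealSemigroup := h A }
  map f :=
    { toMonoidWithZeroHom := MultiringHom.toMonoidWithZeroHom f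
      map_negOne := map_negOne f
      map_mem_rep := map_mem_rep f }

end RealReducedMultiring

/-! ## From real semigroups to real reduced multirings -/

namespace IsRealSemigroup

variable {S : Type u} [CommMonoidWithZero S] {m : S} {D : S → S → Set S}

/-! Each structure determines the other: RS6 and RS4 recover `D` from `D^t`, and in a multiring
`D^t` is the sum. Both functors keep underlying maps, so identity maps give the unit and counit.

From a real semigroup, RS3 is associativity of `D^t` and RS7 makes `0` neutral. The reduced axioms
come from RS5 (two elements agreeing on `d` and `e` agree on all of `D(d,e)`) and from `u + u =
{u}`, which RS7 yields once `1 - 1` is known to be everything.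

From a multiring, the subsets form a commutative monoid in which `{a} + {b²a} = {a}`, so superfluous
summands can be absorbed. This gives `a ∈ a + ax` (RS1), RS4 and `D^t(a,b) ⊆ a + b`. RS5 and RS8
rest on `sq_mem_add_of_mem_rep` and on `a² + b²` having a single element. -/

theorem neg_neg (h : IsRealSemigroup m D) (a : S) : m * (m * a) = a := by
  rw [← mul_assoc, h.negOne_mul_negOne, one_mul]

theorem mul_sq_self (h : IsRealSemigroup m D) (a : S) : a ^ 2 * a = a := by
  rw [← pow_succ, h.cube]

theorem mul_mem_rep (h : IsRealSemigroup m D) {a b c : S} (d : S) (ha : a ∈ D b c) :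
    d * a ∈ D (d * b) (d * c) := by
  simpa only [mul_comm] using h.rs2 a b c d ha

theorem zero_mem_rep (h : IsRealSemigroup m D) (a b : S) : 0 ∈ D a b := by
  -- Zero coefficients in RS4 reduce the claim to `0 ∈ D(0,0)`.
  refine h.rs4 a b 0 0 0 ?_
  simpa using h.rs1 (0 : S) 0

theorem transversalRep_comm (h : IsRealSemigroup m D) {a b c : S}
    (hc : c ∈ transversalRep m D a b) : c ∈ transversalRep m D b a :=
  ⟨(h.rs0 _ _ _).1 hc.1, (h.rs0 _ _ _).1 hc.2.2, (h.rs0 _ _ _).1 hc.2.1⟩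

theorem mul_mem_transversalRep (h : IsRealSemigroup m D) {a b c : S} (d : S)
    (hc : c ∈ transversalRep m D a b) : c * d ∈ transversalRep m D (a * d) (b * d) := by
  refine ⟨h.rs2 _ _ _ d hc.1, ?_, ?_⟩
  · simpa only [mul_assoc] using h.rs2 _ _ _ d hc.2.1
  · simpa only [mul_assoc] using h.rs2 _ _ _ d hc.2.2

theorem mem_transversalRep_neg (h : IsRealSemigroup m D) {x y z : S}
    (hz : z ∈ transversalRep m D x y) : x ∈ transversalRep m D z (m * y) := by
  obtain ⟨h1, h2, h3⟩ := hz
  refine ⟨?_, h.mul_mem_rep m h1, ?_⟩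
  · simpa only [h.neg_neg] using h.mul_mem_rep m h2
  · simpa only [h.neg_neg] using (h.rs0 _ _ _).1 (h.mul_mem_rep m h3)

theorem mem_transversalRep_zero (h : IsRealSemigroup m D) (a : S) :
    a ∈ transversalRep m D a 0 :=
  ⟨h.rs1 _ _, h.rs1 _ _, by simpa using h.zero_mem_rep _ _⟩

theorem zero_mem_transversalRep (h : IsRealSemigroup m D) (a : S) :
    0 ∈ transversalRep m D a (m * a) :=
  h.mem_transversalRep_neg (h.transversalRep_comm (h.mem_transversalRep_zero a))

/-- RS3 applied to `a ∈ a + 0` and `0 ∈ b + (-b)` yields an element of `a + b`. -/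
theorem transversalRep_nonempty (h : IsRealSemigroup m D) (a b : S) :
    (transversalRep m D a b).Nonempty := by
  obtain ⟨x, hx, -⟩ :=
    h.rs3 _ _ _ _ _ (h.mem_transversalRep_zero a) (h.zero_mem_transversalRep b)
  exact ⟨x, hx⟩

theorem mem_transversalRep_zero_iff (h : IsRealSemigroup m D) (x y : S) :
    y ∈ transversalRep m D 0 x ↔ x = y := by
  refine ⟨fun hy => (h.rs7 _ _ ⟨0, ?_, ?_⟩).symm, ?_⟩
  · exact h.mem_transversalRep_neg hy
  · have := h.mul_mem_transversalRep m (h.mem_transversalRep_neg hy)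
    rw [zero_mul, mul_comm y m, mul_comm (m * x) m, h.neg_neg] at this
    exact h.transversalRep_comm this
  · rintro rfl
    exact h.transversalRep_comm (h.mem_transversalRep_zero x)

theorem isCommMultigroup (h : IsRealSemigroup m D) :
    IsCommMultigroup (transversalRep m D) (fun x => m * x) 0 where
  nonempty := h.transversalRep_nonempty
  reversible x y z hz :=
    ⟨h.mem_transversalRep_neg hz, h.transversalRep_comm
      (h.mem_transversalRep_neg (h.transversalRep_comm hz))⟩
  mem_zero_add := h.mem_transversalRep_zero_iff
  assoc x y z := by
    ext a
    simp only [Set.mem_iUnion, exists_prop]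
    constructor
    · rintro ⟨w, hw, ha⟩
      exact h.rs3 _ _ _ _ _ ha hw
    · rintro ⟨t, ht, ha⟩
      obtain ⟨w, hw, ha'⟩ :=
        h.rs3 _ _ _ _ _ (h.transversalRep_comm ha) (h.transversalRep_comm ht)
      exact ⟨w, h.transversalRep_comm hw, h.transversalRep_comm ha'⟩
  comm x y := Set.ext fun _ => ⟨h.transversalRep_comm, h.transversalRep_comm⟩

/-- `1 - 1` is the whole real semigroup. -/
theorem mem_transversalRep_one_negOne (h : IsRealSemigroup m D) (a : S) :
    a ∈ transversalRep m D 1 m := by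
  -- RS6 at the element `1` upgrades `1 ∈ D(1,-a)` to `1 ∈ 1 - a`; reversing gives `a ∈ 1 - 1`.
  have h1 := h.rs6 _ _ _ (h.rs1 1 (m * a))
  simp only [one_pow, one_mul] at h1
  have h2 := h.mem_transversalRep_neg (h.transversalRep_comm h1)
  have h3 := h.mul_mem_transversalRep m h2
  rw [mul_comm (m * a) m, h.neg_neg, one_mul, mul_one, h.negOne_mul_negOne] at h3
  exact h.transversalRep_comm h3

/-- RS5 gives `u²v = v`, so scaling `vu ∈ 1 - 1` by `u` yields `v ∈ u - u`. Then `u` lies in both `v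
- u` and `u - v`, and RS7 applies. -/
theorem eq_of_mem_transversalRep_self (h : IsRealSemigroup m D) {u v : S}
    (hv : v ∈ transversalRep m D u u) : v = u := by
  have h1 : u ^ 2 * v = 1 * v := by
    refine h.rs5 _ _ _ u u ?_ ?_ hv.1 <;> rw [h.mul_sq_self, one_mul]
  have h2 := h.mul_mem_transversalRep u (h.mem_transversalRep_one_negOne (v * u))
  rw [one_mul, mul_assoc, ← sq, mul_comm v, h1, one_mul] at h2
  refine h.rs7 _ _ ⟨u, h.mem_transversalRep_neg hv, ?_⟩
  have h3 := h.mem_transversalRep_neg (h.transversalRep_comm h2)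
  have h4 := h.mul_mem_transversalRep m h3
  rw [mul_comm (m * u) m, mul_comm v m, h.neg_neg] at h4
  exact h.transversalRep_comm h4

theorem eq_sq_mul_of_mem_rep_self (h : IsRealSemigroup m D) {a c : S} (hc : c ∈ D a a) :
    c = c ^ 2 * a :=
  h.eq_of_mem_transversalRep_self (h.rs6 _ _ _ hc)

theorem eq_of_mem_transversalRep_mul_sq (h : IsRealSemigroup m D) {a b c : S}
    (hc : c ∈ transversalRep m D a (a * b ^ 2)) : c = a := by
  have hcb : c * b ^ 2 = a * b ^ 2 := by
    apply h.eq_of_mem_transversalRep_self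
    have hb : b ^ 2 * b ^ 2 = b ^ 2 := by rw [← pow_add, pow_succ, h.cube, ← sq]
    have := h.mul_mem_transversalRep (b ^ 2) hc
    rwa [mul_assoc, hb] at this
  have hca : c = c ^ 2 * a := by
    apply h.eq_sq_mul_of_mem_rep_self
    refine h.rs4 a a 1 b c ?_
    rw [one_pow, one_mul, mul_comm]
    exact hc.1
  -- `c²` and `1` agree on `c` and on `-ab² = -cb²`, hence on `a ∈ c - ab²`.
  have hac : c ^ 2 * a = 1 * a := by
    refine h.rs5 _ _ _ c (m * (a * b ^ 2)) ?_ ?_ (h.mem_transversalRep_neg hc).1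
    · rw [h.mul_sq_self, one_mul]
    · rw [one_mul, mul_left_comm, ← hcb, ← mul_assoc (c ^ 2), h.mul_sq_self]
  rw [hca, hac, one_mul]

/-- Here `c` acts as `1` on `a²` and on `b²`, hence by RS5 on `d`. Exchanging `c` and `d` then gives
`c = d`. -/
theorem mul_eq_of_mem_sq_add_sq (h : IsRealSemigroup m D) {a b c d : S}
    (hc : c ∈ transversalRep m D (a ^ 2) (b ^ 2))
    (hd : d ∈ transversalRep m D (a ^ 2) (b ^ 2)) : c * d = d := by
  have key : ∀ x y : S, c ∈ transversalRep m D (x ^ 2) (y ^ 2) → c * x ^ 2 = 1 * x ^ 2 := by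
    intro x y hx
    rw [one_mul]
    apply h.eq_of_mem_transversalRep_mul_sq (b := y)
    have := h.mul_mem_transversalRep (x ^ 2) hx
    rwa [mul_comm (y ^ 2), sq x, ← mul_assoc (x * x), ← sq, h.mul_sq_self, ← sq] at this
  have := h.rs5 c 1 d _ _ (key _ _ hc) (key _ _ (h.transversalRep_comm hc)) hd.1
  rwa [one_mul] at this

theorem isRealReducedMultiring (h : IsRealSemigroup m D) :
    IsRealReducedMultiring (transversalRep m D) (fun x => m * x) where
  multigroup := h.isCommMultigroup
  mul_mem _ _ _ d hc := h.mul_mem_transversalRep d hc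
  one_ne_zero h10 := h.negOne_ne_one (by rw [← mul_one m, h10, mul_zero])
  cube := h.cube
  eq_of_mem_add_mul_sq _ _ _ hc := h.eq_of_mem_transversalRep_mul_sq hc
  eq_of_mem_sq_add_sq a b c d hc hd := by
    rw [← h.mul_eq_of_mem_sq_add_sq hd hc, mul_comm, h.mul_eq_of_mem_sq_add_sq hc hd]

/-- This is how `D` is recovered from `D^t`: RS4 and RS6 are the two directions. -/
theorem mem_transversalRep_sq_mul_iff (h : IsRealSemigroup m D) (a b d : S) :
    d ∈ transversalRep m D (d ^ 2 * a) (d ^ 2 * b) ↔ d ∈ D a b :=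
  ⟨fun hd => h.rs4 _ _ _ _ _ hd.1, h.rs6 _ _ _⟩

end IsRealSemigroup

/-! ## From real reduced multirings to real semigroups -/

namespace Multiring

variable (A : Multiring.{u})

/-- The sum of two subsets of a multiring. -/
def setAdd (s t : Set A.carrier) : Set A.carrier := {c | ∃ a ∈ s, ∃ b ∈ t, c ∈ A.add a b}

variable {A}

theorem mem_add_comm {a b c : A.carrier} (h : c ∈ A.add a b) : c ∈ A.add b a := by
  rwa [A.isMultiring.multigroup.comm]

theorem setAdd_comm (s t : Set A.carrier) : A.setAdd s t = A.setAdd t s := by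
  ext c
  constructor <;>
  · rintro ⟨a, ha, b, hb, hc⟩
    exact ⟨b, hb, a, ha, mem_add_comm hc⟩

theorem exists_mem_add_of_mem_add {a b d w c : A.carrier} (hc : c ∈ A.add a w)
    (hw : w ∈ A.add b d) : ∃ t ∈ A.add a b, c ∈ A.add t d := by
  have h : c ∈ ⋃ w ∈ A.add b d, A.add a w := Set.mem_biUnion hw hc
  rw [A.isMultiring.multigroup.assoc] at h
  simpa using h

theorem exists_mem_add_of_mem_add' {a b d t c : A.carrier} (hc : c ∈ A.add t d)
    (ht : t ∈ A.add a b) : ∃ w ∈ A.add b d, c ∈ A.add a w := by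
  have h : c ∈ ⋃ t ∈ A.add a b, A.add t d := Set.mem_biUnion ht hc
  rw [← A.isMultiring.multigroup.assoc] at h
  simpa using h

theorem setAdd_assoc (s t r : Set A.carrier) :
    A.setAdd (A.setAdd s t) r = A.setAdd s (A.setAdd t r) := by
  ext c
  constructor
  · rintro ⟨x, ⟨a, ha, b, hb, hx⟩, d, hd, hc⟩
    obtain ⟨w, hw, hc'⟩ := exists_mem_add_of_mem_add' hc hx
    exact ⟨a, ha, w, ⟨b, hb, d, hd, hw⟩, hc'⟩
  · rintro ⟨a, ha, x, ⟨b, hb, d, hd, hx⟩, hc⟩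
    obtain ⟨w, hw, hc'⟩ := exists_mem_add_of_mem_add hc hx
    exact ⟨w, ⟨a, ha, b, hb, hw⟩, d, hd, hc'⟩

theorem zero_setAdd (s : Set A.carrier) : A.setAdd {0} s = s := by
  ext c
  simp [setAdd, A.isMultiring.multigroup.mem_zero_add]

instance : Zero (Set A.carrier) := ⟨{0}⟩

instance : Add (Set A.carrier) := ⟨A.setAdd⟩

/-- Multivalued associativity becomes ordinary associativity on subsets, so long sums can be
rearranged by `abel`. -/
instance : AddCommMonoid (Set A.carrier) where
  nsmul := nsmulRec
  add_assoc := setAdd_assoc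
  zero_add := zero_setAdd
  add_zero s := (setAdd_comm _ _).trans (zero_setAdd s)
  add_comm := setAdd_comm

theorem set_add_mono {s s' t t' : Set A.carrier} (hs : s ⊆ s') (ht : t ⊆ t') :
    s + t ⊆ s' + t' := by
  rintro c ⟨a, ha, b, hb, hc⟩
  exact ⟨a, hs ha, b, ht hb, hc⟩

theorem singleton_add_singleton (a b : A.carrier) : ({a} + {b} : Set A.carrier) = A.add a b := by
  ext c
  exact ⟨by rintro ⟨_, rfl, _, rfl, h⟩; exact h, fun h => ⟨a, rfl, b, rfl, h⟩⟩

theorem mul_mem_add {a b c : A.carrier} (d : A.carrier) (h : c ∈ A.add a b) :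
    d * c ∈ A.add (d * a) (d * b) := by
  simpa only [mul_comm] using A.isMultiring.mul_mem a b c d h

theorem zero_mem_add_neg (a : A.carrier) : 0 ∈ A.add a (A.neg a) :=
  (A.isMultiring.multigroup.reversible 0 a a ((A.isMultiring.multigroup.mem_zero_add a a).2 rfl)).1

theorem eq_neg_of_zero_mem_add {a b : A.carrier} (h : 0 ∈ A.add a b) : A.neg a = b := by
  have := (A.isMultiring.multigroup.reversible _ _ _ h).2
  exact ((A.isMultiring.multigroup.mem_zero_add _ _).1 (mem_add_comm this))

theorem neg_eq_neg_one_mul (a : A.carrier) : A.neg a = A.neg 1 * a := by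
  apply eq_neg_of_zero_mem_add
  simpa using A.isMultiring.mul_mem _ _ _ a (zero_mem_add_neg 1)

theorem neg_neg (a : A.carrier) : A.neg (A.neg a) = a :=
  eq_neg_of_zero_mem_add (mem_add_comm (zero_mem_add_neg a))

theorem neg_one_mul_neg_one_mul (a : A.carrier) : A.neg 1 * (A.neg 1 * a) = a := by
  rw [← neg_eq_neg_one_mul, ← neg_eq_neg_one_mul, neg_neg]

theorem mem_sub_of_mem_add {a b c : A.carrier} (h : c ∈ A.add a b) :
    a ∈ A.add c (A.neg 1 * b) := by
  rw [← neg_eq_neg_one_mul]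
  exact (A.isMultiring.multigroup.reversible _ _ _ h).1

theorem mem_add_of_mem_sub {a b c : A.carrier} (h : c ∈ A.add a (A.neg 1 * b)) :
    a ∈ A.add c b := by
  simpa only [neg_one_mul_neg_one_mul] using mem_sub_of_mem_add h

end Multiring

/-! ### Absorption, and the identity `D^t(a,b) = a + b` -/

namespace RealReducedMultiring

open Multiring

variable {A : RealReducedMultiring.{u}}

theorem mul_mul_self (a : A.carrier) : a * (a * a) = a := by
  rw [← mul_assoc, ← pow_three', A.isRealReduced.cube]

theorem mul_mul_mul_self (a b : A.carrier) : a * (a * (a * b)) = a * b := by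
  simpa only [mul_assoc] using congrArg (· * b) (mul_mul_self a)

theorem mem_add_mul_sq_iff (a b c : A.carrier) : c ∈ A.add a (a * b ^ 2) ↔ c = a := by
  refine ⟨A.isRealReduced.eq_of_mem_add_mul_sq a b c, ?_⟩
  rintro rfl
  obtain ⟨d, hd⟩ := A.isMultiring.multigroup.nonempty c (c * b ^ 2)
  rwa [A.isRealReduced.eq_of_mem_add_mul_sq c b d hd] at hd

theorem singleton_add_mul_sq (a b : A.carrier) : ({a} + {b ^ 2 * a} : Set A.carrier) = {a} := by
  ext c
  rw [singleton_add_singleton, mul_comm, mem_add_mul_sq_iff, Set.mem_singleton_iff]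

theorem singleton_add_self (a : A.carrier) : ({a} + {a} : Set A.carrier) = {a} := by
  simpa using singleton_add_mul_sq a 1

theorem mem_add_self_iff (a c : A.carrier) : c ∈ A.add a a ↔ c = a := by
  rw [← singleton_add_singleton, singleton_add_self, Set.mem_singleton_iff]

/-- For `t ∈ 1 + x`, `t² ∈ t + tx ⊆ (1 + x) + (x + x²) = 1 + x`. Hence `1 = 1 + t² ⊆ 1 + (1 + x) = 1
+ x`. -/
theorem one_mem_one_add (x : A.carrier) : 1 ∈ A.add 1 x := by
  obtain ⟨t, ht⟩ := A.isMultiring.multigroup.nonempty 1 x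
  have h1 : ({t * 1} + {t * x} : Set A.carrier) ⊆ ({1} + {x}) + ({x} + {x ^ 2}) := by
    refine set_add_mono ?_ ?_
    · rw [singleton_add_singleton]; simpa using ht
    · rw [singleton_add_singleton]
      simpa [sq] using A.isMultiring.mul_mem _ _ _ x ht
  have h2 : ({1} + {x} + ({x} + {x ^ 2}) : Set A.carrier) = {1} + {x} := by
    have e1 := singleton_add_self x
    have e2 := singleton_add_mul_sq (1 : A.carrier) x
    rw [mul_one] at e2
    calc _ = ({1} + {x ^ 2} + ({x} + {x}) : Set A.carrier) := by abel
      _ = _ := by rw [e1, e2]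
  have h3 : ({t ^ 2} : Set A.carrier) ⊆ {1} + {x} := by
    rw [← h2]
    refine subset_trans ?_ h1
    rw [singleton_add_singleton, Set.singleton_subset_iff, sq]
    exact mul_mem_add t ht
  have h4 : ({1} + {t ^ 2} : Set A.carrier) ⊆ {1} + {x} := by
    refine (set_add_mono subset_rfl h3).trans ?_
    rw [← add_assoc, singleton_add_self]
  have h5 := singleton_add_mul_sq (1 : A.carrier) t
  rw [mul_one] at h5
  rw [h5, Set.singleton_subset_iff, singleton_add_singleton] at h4
  exact h4

theorem mem_add_self_mul (a x : A.carrier) : a ∈ A.add a (a * x) := by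
  simpa using mul_mem_add a (one_mem_one_add x)

theorem mul_mem_sub_self (a x : A.carrier) : a * x ∈ A.add a (A.neg 1 * a) :=
  mem_sub_of_mem_add (mem_add_comm (mem_add_self_mul a x))

theorem mem_rep_of_mem_add {a b d : A.carrier} (h : d ∈ A.add a b) : d ∈ A.rep a b := by
  have := mul_mem_add (d ^ 2) h
  rwa [← pow_succ, A.isRealReduced.cube] at this

theorem add_subset_transversalRep (a b : A.carrier) :
    A.add a b ⊆ transversalRep A.negOne A.rep a b := by
  intro d h
  refine ⟨mem_rep_of_mem_add h, mem_rep_of_mem_add ?_, mem_rep_of_mem_add ?_⟩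
  · simpa only [negOne, neg_one_mul_neg_one_mul] using
      mul_mem_add (A.neg 1) (mem_sub_of_mem_add h)
  · simpa only [negOne, neg_one_mul_neg_one_mul] using
      mem_add_comm (mul_mem_add (A.neg 1) (mem_sub_of_mem_add (mem_add_comm h)))

/-- The sum `p + q + r` absorbs `-p` as soon as `-p ∈ p²q + p²r`. -/
theorem add_neg_subset {p q r : A.carrier} {p' : A.carrier}
    (h : p' ∈ A.add (p ^ 2 * q) (p ^ 2 * r)) :
    ({p} + {q} + {r} + {p'} : Set A.carrier) ⊆ {p} + {q} + {r} := by
  rw [← singleton_add_singleton, ← Set.singleton_subset_iff] at h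
  refine (set_add_mono subset_rfl h).trans (subset_of_eq ?_)
  calc ({p} + {q} + {r} + ({p ^ 2 * q} + {p ^ 2 * r}) : Set A.carrier)
      = {p} + ({q} + {p ^ 2 * q}) + ({r} + {p ^ 2 * r}) := by abel
    _ = _ := by rw [singleton_add_mul_sq, singleton_add_mul_sq]

/-- The three conditions in `D^t` let `d - a - b` absorb `-d`, `a` and `b` in turn. Since `0 ∈ (d -
d) + (a - a) + (b - b)`, it follows that `0 ∈ d - a - b`. -/
theorem transversalRep_subset_add (a b : A.carrier) :
    transversalRep A.negOne A.rep a b ⊆ A.add a b := by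
  rintro d ⟨h1, h2, h3⟩
  simp only [rep, negOne, Set.mem_ofPred_eq] at h1 h2 h3
  set m := A.neg 1 with hm
  have hmm : m * m = 1 := by simpa using neg_one_mul_neg_one_mul (A := A.toMultiring) 1
  have hneg : ∀ x, ({0} : Set A.carrier) ⊆ {x} + {m * x} := fun x => by
    rw [singleton_add_singleton, Set.singleton_subset_iff, hm, ← neg_eq_neg_one_mul]
    exact zero_mem_add_neg x
  have hsq : ∀ x : A.carrier, (m * x) ^ 2 = x ^ 2 := fun x => by
    rw [mul_pow, sq m, hmm, one_mul]
  have hd : ({d} + {m * a} + {m * b} + {m * d} : Set A.carrier) ⊆ {d} + {m * a} + {m * b} := by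
    apply add_neg_subset
    rw [mul_left_comm, mul_left_comm _ m]
    exact mul_mem_add m h1
  have ha : ({m * a} + {d} + {m * b} + {a} : Set A.carrier) ⊆ {m * a} + {d} + {m * b} := by
    apply add_neg_subset
    have := mul_mem_add m h2
    rw [mul_left_comm _ m, neg_one_mul_neg_one_mul, neg_one_mul_neg_one_mul] at this
    rwa [mul_left_comm _ m]
  have hb : ({m * b} + {d} + {m * a} + {b} : Set A.carrier) ⊆ {m * b} + {d} + {m * a} := by
    apply add_neg_subset
    have := mem_add_comm (mul_mem_add m h3)
    rw [mul_left_comm _ m, neg_one_mul_neg_one_mul, neg_one_mul_neg_one_mul] at this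
    rwa [mul_left_comm _ m]
  have key : ({0} : Set A.carrier) ⊆ {d} + {m * a} + {m * b} := by
    calc ({0} : Set A.carrier) = {0} + {0} + {0} := by
          change (0 : Set A.carrier) = 0 + 0 + 0
          simp
      _ ⊆ ({d} + {m * d}) + ({a} + {m * a}) + ({b} + {m * b}) :=
          set_add_mono (set_add_mono (hneg d) (hneg a)) (hneg b)
      _ = ({d} + {m * a} + {m * b} + {m * d}) + {a} + {b} := by abel
      _ ⊆ ({d} + {m * a} + {m * b}) + {a} + {b} :=
          set_add_mono (set_add_mono hd subset_rfl) subset_rfl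
      _ = ({m * a} + {d} + {m * b} + {a}) + {b} := by abel
      _ ⊆ ({m * a} + {d} + {m * b}) + {b} := set_add_mono ha subset_rfl
      _ = {m * b} + {d} + {m * a} + {b} := by abel
      _ ⊆ {m * b} + {d} + {m * a} := hb
      _ = _ := by abel
  obtain ⟨t, ht, x, rfl, h0⟩ := Set.singleton_subset_iff.1 key
  change t ∈ ({d} + {m * a} : Set A.carrier) at ht
  rw [singleton_add_singleton] at ht
  have htb : t = b := by
    have := eq_neg_of_zero_mem_add (mem_add_comm h0)
    rw [neg_eq_neg_one_mul, neg_one_mul_neg_one_mul] at this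
    exact this.symm
  subst htb
  exact mem_add_comm (mem_add_of_mem_sub ht)

theorem transversalRep_eq_add (a b : A.carrier) :
    transversalRep A.negOne A.rep a b = A.add a b :=
  (transversalRep_subset_add a b).antisymm (add_subset_transversalRep a b)

/-! ### Supports, and the real semigroup axioms -/

theorem mul_sq_of_mem_sq_add_sq {a b s : A.carrier} (h : s ∈ A.add (a ^ 2) (b ^ 2)) :
    a * s = a := by
  rw [← mem_add_mul_sq_iff a b]
  have := mul_mem_add a h
  rwa [← pow_succ', A.isRealReduced.cube] at this

/-- The support of an element represented by `a, b` lies in the union of the supports of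
`a` and `b`. -/
theorem sq_mem_add_of_mem_rep {a b c : A.carrier} (h : c ∈ A.rep a b) :
    c ^ 2 ∈ A.add ((c * a) ^ 2) ((c * b) ^ 2) := by
  -- The unique element `s` of the sum fixes `ca` and `cb`, so `c² ∈ ca + cb ⊆ (s - s) + (s - s) = s
  -- - s`. Reversing, `s ∈ c² + s = c² + c²s²`, which forces `s = c²`.
  obtain ⟨s, hs⟩ := A.isMultiring.multigroup.nonempty ((c * a) ^ 2) ((c * b) ^ 2)
  suffices s = c ^ 2 by rwa [this] at hs
  have ha : c * a * s = c * a := mul_sq_of_mem_sq_add_sq hs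
  have hb : c * b * s = c * b := mul_sq_of_mem_sq_add_sq (mem_add_comm hs)
  have hss : s ^ 2 = s := by
    refine A.isRealReduced.eq_of_mem_sq_add_sq (c * a) (c * b) _ _ ?_ hs
    have := mul_mem_add s hs
    rwa [← sq, mul_comm s, mul_comm s, sq (c * a), mul_assoc (c * a), ha, sq (c * b),
      mul_assoc (c * b), hb, ← sq, ← sq] at this
  have hcs : c ^ 2 * s = s := by
    refine A.isRealReduced.eq_of_mem_sq_add_sq (c * a) (c * b) _ _ ?_ hs
    have := mul_mem_add (c ^ 2) hs
    have e : ∀ x : A.carrier, c ^ 2 * (c * x) ^ 2 = (c * x) ^ 2 := fun x => by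
      simp only [sq, mul_comm, mul_left_comm, mul_mul_mul_self]
    rwa [e, e] at this
  have h1 : c ^ 2 ∈ A.add (c * a) (c * b) := by
    have := mul_mem_add c h
    have e : ∀ x : A.carrier, c * (c ^ 2 * x) = c * x := fun x => by
      simp only [sq, mul_assoc, mul_mul_mul_self]
    rwa [e, e, ← sq] at this
  have hsub : ∀ x, c * x * s = c * x →
      ({c * x} : Set A.carrier) ⊆ {s} + {A.neg 1 * s} := fun x hx => by
    rw [singleton_add_singleton, Set.singleton_subset_iff, ← hx, mul_comm (c * x)]
    exact mul_mem_sub_self _ _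
  have h2 : c ^ 2 ∈ A.add s (A.neg 1 * s) := by
    have h3 := set_add_mono (hsub a ha) (hsub b hb)
    have h4 : ({s} + {A.neg 1 * s} + ({s} + {A.neg 1 * s}) : Set A.carrier) =
        {s} + {A.neg 1 * s} := by
      calc _ = ({s} + {s} + ({A.neg 1 * s} + {A.neg 1 * s}) : Set A.carrier) := by abel
        _ = _ := by rw [singleton_add_self, singleton_add_self]
    rw [h4, singleton_add_singleton, singleton_add_singleton] at h3
    exact h3 h1
  have h5 := mem_add_of_mem_sub h2
  rw [← mem_add_mul_sq_iff _ s, hss, hcs]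
  exact h5

/-- The products `a²s`, `abs` and `b²s` all lie in the one-element set `(ad)² + (ae)²`, so they
coincide; `x³ = x` then gives `as = bs`. -/
theorem mul_eq_mul_of_mem_sq_add_sq {a b d e s : A.carrier} (hd : a * d = b * d)
    (he : a * e = b * e) (hs : s ∈ A.add (d ^ 2) (e ^ 2)) : a * s = b * s := by
  have key : ∀ x y : A.carrier, x * d = a * d → x * e = a * e → y * d = a * d →
      y * e = a * e → x * y * s ∈ A.add ((a * d) ^ 2) ((a * e) ^ 2) := by
    intro x y h1 h2 h3 h4
    have e : ∀ z : A.carrier, x * z = a * z → y * z = a * z → x * y * z ^ 2 = (a * z) ^ 2 := by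
      intro z hx hy
      rw [sq, mul_mul_mul_comm, hx, hy, ← sq]
    have := mul_mem_add (x * y) hs
    rwa [e d h1 h3, e _ h2 h4] at this
  have haa := key a a rfl rfl rfl rfl
  have hab := key a b rfl rfl hd.symm he.symm
  have hbb := key b b hd.symm he.symm hd.symm he.symm
  have e1 := A.isRealReduced.eq_of_mem_sq_add_sq _ _ _ _ haa hab
  have e2 := A.isRealReduced.eq_of_mem_sq_add_sq _ _ _ _ haa hbb
  calc a * s = a * (a * a * s) := by simp only [mul_assoc, mul_mul_mul_self]
    _ = a * (b * b * s) := by rw [e2]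
    _ = b * (a * b * s) := by simp only [mul_left_comm, mul_assoc]
    _ = b * (a * a * s) := by rw [e1]
    _ = b * s := by rw [e2]; simp only [mul_assoc, mul_mul_mul_self]

theorem mem_rep_of_mem_rep_sq_mul {a b c d e : A.carrier}
    (h : e ∈ A.rep (c ^ 2 * a) (d ^ 2 * b)) : e ∈ A.rep a b := by
  have h1 : ({e} : Set A.carrier) ⊆ {e} + {e ^ 2 * a} := by
    rw [singleton_add_singleton, Set.singleton_subset_iff, sq, mul_assoc]
    exact mem_add_self_mul _ _
  have h2 : ({e} : Set A.carrier) ⊆ {e} + {e ^ 2 * b} := by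
    rw [singleton_add_singleton, Set.singleton_subset_iff, sq, mul_assoc]
    exact mem_add_self_mul _ _
  have h3 : ({e} : Set A.carrier) ⊆ {c ^ 2 * (e ^ 2 * a)} + {d ^ 2 * (e ^ 2 * b)} := by
    rw [singleton_add_singleton, Set.singleton_subset_iff, mul_left_comm, mul_left_comm (d ^ 2)]
    exact h
  have h4 : ({e} : Set A.carrier) ⊆ {e ^ 2 * a} + {e ^ 2 * b} := by
    -- Enlarge `e` to `e + e²a + e²b`, expand `e` by the hypothesis, then absorb the multiples by
    -- `c²` and `d²`.
    calc ({e} : Set A.carrier) ⊆ {e} + {e ^ 2 * b} := h2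
      _ ⊆ {e} + {e ^ 2 * a} + {e ^ 2 * b} := set_add_mono h1 subset_rfl
      _ ⊆ {c ^ 2 * (e ^ 2 * a)} + {d ^ 2 * (e ^ 2 * b)} + {e ^ 2 * a} + {e ^ 2 * b} :=
          set_add_mono (set_add_mono h3 subset_rfl) subset_rfl
      _ = ({e ^ 2 * a} + {c ^ 2 * (e ^ 2 * a)}) + ({e ^ 2 * b} + {d ^ 2 * (e ^ 2 * b)}) := by abel
      _ = _ := by rw [singleton_add_mul_sq, singleton_add_mul_sq]
  rwa [singleton_add_singleton, Set.singleton_subset_iff] at h4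

theorem isRealSemigroup (A : RealReducedMultiring.{u}) : IsRealSemigroup A.negOne A.rep where
  cube := A.isRealReduced.cube
  negOne_ne_one h := by
    have := zero_mem_add_neg (A := A.toMultiring) 1
    rw [show A.neg 1 = 1 from h, mem_add_self_iff] at this
    exact A.isRealReduced.one_ne_zero this.symm
  negOne_mul_negOne := by
    simpa [negOne] using neg_one_mul_neg_one_mul (A := A.toMultiring) 1
  eq_zero_of_eq_neg x hx := by
    have := zero_mem_add_neg (A := A.toMultiring) x
    rw [neg_eq_neg_one_mul, show A.neg 1 * x = x from hx.symm, mem_add_self_iff] at this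
    exact this.symm
  rs0 a b c := ⟨mem_add_comm, mem_add_comm⟩
  rs1 a b := by
    change a ∈ A.add (a ^ 2 * a) (a ^ 2 * b)
    rw [← pow_succ, A.isRealReduced.cube, sq, mul_assoc]
    exact mem_add_self_mul _ _
  rs2 a b c d h := by
    change a * d ∈ A.add ((a * d) ^ 2 * (b * d)) ((a * d) ^ 2 * (c * d))
    have e : ∀ x : A.carrier, (a * d) ^ 2 * (x * d) = a ^ 2 * x * d := fun x => by
      simp only [sq, mul_comm, mul_left_comm, mul_mul_mul_self]
    rw [e, e]
    exact A.isMultiring.mul_mem _ _ _ d h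
  rs3 a b c d e ha hc := by
    simp only [transversalRep_eq_add] at *
    exact exists_mem_add_of_mem_add ha hc
  rs4 _ _ _ _ _ h := mem_rep_of_mem_rep_sq_mul h
  rs5 a b c d e hd he hc := by
    have := mul_eq_mul_of_mem_sq_add_sq (a := a) (b := b) (d := c * d) (e := c * e)
      (by rw [mul_left_comm, hd, mul_left_comm]) (by rw [mul_left_comm, he, mul_left_comm])
      (sq_mem_add_of_mem_rep hc)
    calc a * c = a * c ^ 2 * c := by rw [mul_assoc, ← pow_succ, A.isRealReduced.cube]
      _ = b * c := by rw [this, mul_assoc, ← pow_succ, A.isRealReduced.cube]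
  rs6 a b c h := by
    rw [transversalRep_eq_add]
    exact h
  rs7 a b h := by
    obtain ⟨t, h1, h2⟩ := h
    rw [transversalRep_eq_add] at h1 h2
    -- From `a ∈ b + t` and `t ∈ b - a`, `a ∈ (b + b) - a = b - a`, so `b ∈ a + a = {a}`.
    obtain ⟨w, hw, hw'⟩ := exists_mem_add_of_mem_add (mem_add_comm (mem_add_of_mem_sub h1)) h2
    rw [mem_add_self_iff] at hw
    subst hw
    have := mem_add_of_mem_sub hw'
    rw [mem_add_self_iff] at this
    exact this.symm
  rs8 a b c h := by
    change a ^ 2 ∈ A.add ((a ^ 2) ^ 2 * b ^ 2) ((a ^ 2) ^ 2 * c ^ 2)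
    have e : ∀ x : A.carrier, (a ^ 2) ^ 2 * x ^ 2 = (a * x) ^ 2 := fun x => by
      simp only [sq, mul_comm, mul_left_comm, mul_mul_mul_self]
    rw [e, e]
    exact sq_mem_add_of_mem_rep h

end RealReducedMultiring

/-! ## The equivalence -/

namespace RealSemigroup

variable (hM : ∀ G : RealSemigroup.{u}, IsRealReducedMultiring G.sum G.opp)
  (hS : ∀ A : RealReducedMultiring.{u}, IsRealSemigroup A.negOne A.rep)

/-- The identity map of a real semigroup, as an isomorphism to the real semigroup of its
multiring. -/
def unitIso (G : RealSemigroup.{u}) :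
    G ≅ (RealReducedMultiring.toRealSemigroupFunctor hS).obj ((toMultiringFunctor hM).obj G) where
  hom := RealSemigroupHom.mk (MonoidWithZeroHom.id G.carrier) (mul_one G.negOne).symm
    fun a b c h => (G.isRealSemigroup.mem_transversalRep_sq_mul_iff b c a).2 h
  inv := RealSemigroupHom.mk (MonoidWithZeroHom.id G.carrier) (mul_one G.negOne)
    fun a b c h => (G.isRealSemigroup.mem_transversalRep_sq_mul_iff b c a).1 h
  hom_inv_id := rfl
  inv_hom_id := rfl

/-- The identity map of a real reduced multiring, as an isomorphism from the multiring of its real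
semigroup. -/
def counitIso (A : RealReducedMultiring.{u}) :
    (toMultiringFunctor hM).obj ((RealReducedMultiring.toRealSemigroupFunctor hS).obj A) ≅ A where
  hom := MultiringHom.mk (MonoidWithZeroHom.id A.carrier)
    (fun a b _ h => RealReducedMultiring.transversalRep_subset_add (A := A) a b h)
    fun a => (Multiring.neg_eq_neg_one_mul (A := A.toMultiring) a).symm
  inv := MultiringHom.mk (MonoidWithZeroHom.id A.carrier)
    (fun a b _ h => RealReducedMultiring.add_subset_transversalRep (A := A) a b h)
    fun a => Multiring.neg_eq_neg_one_mul (A := A.toMultiring) a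
  hom_inv_id := rfl
  inv_hom_id := rfl

/-- The equivalence between real semigroups and real reduced multirings. -/
def equivRealReducedMultiring : RealSemigroup.{u} ≌ RealReducedMultiring.{u} :=
  CategoryTheory.Equivalence.mk (toMultiringFunctor hM)
    (RealReducedMultiring.toRealSemigroupFunctor hS)
    (NatIso.ofComponents (unitIso hM hS) fun _ => rfl)
    (NatIso.ofComponents (counitIso hM hS) fun _ => rfl)

end RealSemigroup

theorem mainTheorem4 :
    ∃ (hM : ∀ G : RealSemigroup.{u}, IsRealReducedMultiring G.sum G.opp)
      (hS : ∀ A : RealReducedMultiring.{u}, IsRealSemigroup A.negOne A.rep),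
      (∀ (A : RealReducedMultiring.{u}) (a b : A.carrier),
        transversalRep A.negOne A.rep a b = A.add a b) ∧
      ∃ e : RealSemigroup.{u} ≌ RealReducedMultiring.{u},
        e.functor = RealSemigroup.toMultiringFunctor hM ∧
        e.inverse = RealReducedMultiring.toRealSemigroupFunctor hS :=
  ⟨fun G => G.isRealSemigroup.isRealReducedMultiring, RealReducedMultiring.isRealSemigroup,
    fun _ => RealReducedMultiring.transversalRep_eq_add,
    RealSemigroup.equivRealReducedMultiring _ _, rfl, rfl⟩
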